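/- Let $d \ge 1$ and let $(X,\mu)$ be a probability space whose $\sigma$-algebra contains a countable family of sets separating the points of $X$ (for instance, a standard Borel or Lebesgue space). Let $\{T^z\}_{z \in \mathbb{Z}^d}$ be an action of $\mathbb{Z}^d$ on $X$ by measurable $\mu$-preserving bijections. Suppose the action is ergodic, that is, every measurable set $A$ with $\mu(T^zA \,\triangle\, A) = 0$ for all $z \in \mathbb{Z}^d$ has $\mu(A) \in \{0,1\}$, and free, that is, for $\mu$-almost every $x \in X$ one has $T^z x \ne x$ for all $z \ne 0$. For an integer $N \ge 1$ put $$Q_N = \{z = (z_1,\dots,z_d) \in \mathbb{Z}^d : 1 \le z_1,\dots,z_d \le N\}.$$ Then for every integer $N \ge 1$ and every $\varepsilon > 0$ there exists a measurable set $B \subseteq X$ such that the sets $T^z B$, $z \in Q_N$, are pairwise disjoint and $$\mu\Big(\bigsqcup_{z \in Q_N} T^z B\Big) > 1 - \varepsilon.$$ -/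

import Mathlib

open MeasureTheory
open scoped Pointwise

/-- The cube `Q_N = {z ∈ ℤ^d : 1 ≤ z_1, …, z_d ≤ N}`. -/
def cube (d N : ℕ) : Set (Fin d → ℤ) :=
  {z | ∀ i, 1 ≤ z i ∧ z i ≤ (N : ℤ)}

/-- A measurable action of `ℤ^d` is free (with respect to `μ`) if almost every point has
trivial stabilizer. -/
def IsFreeAction (d : ℕ) {X : Type*} [MeasurableSpace X] [AddAction (Fin d → ℤ) X]
    (μ : Measure X) : Prop :=
  ∀ᵐ x ∂μ, ∀ z : Fin d → ℤ, z ≠ 0 → z +ᵥ x ≠ x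

/-- `B` is the base of a tower of height `N`: it is measurable and its translates `T^z B`,
`z ∈ Q_N`, are pairwise disjoint. -/
def IsTowerBase (d N : ℕ) {X : Type*} [MeasurableSpace X] [AddAction (Fin d → ℤ) X]
    (B : Set X) : Prop :=
  MeasurableSet B ∧ (cube d N).PairwiseDisjoint fun z => z +ᵥ B

/-- The tower `Q_N B`: the union of the translates `T^z B`, `z ∈ Q_N`. -/
def tower (d N : ℕ) {X : Type*} [AddAction (Fin d → ℤ) X] (B : Set X) : Set X :=
  ⋃ z ∈ cube d N, z +ᵥ B

/-! The tower is enlarged step by step. Take a tower `A` of height `N * K` with `K` large and cut it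
into towers of height `N`. Up to measure `(1 + 1/K)^d * μ A`, every point `x` has `Q_N x` disjoint
from `A`. A maximal set `C` of such points with disjoint cubes carries a tower filling at least a
fraction `2^{-d}` of them, since `(2N)^d` translates of `C` cover them almost surely. So each step
(`IsTowerBase.exists_larger`) shrinks the uncovered part by a fixed factor below 1. -/

section Separation

variable {G X : Type*} [AddGroup G] [MeasurableSpace X] [AddAction G X] [MeasurableConstVAdd G X]

/-- Countably many measurable sets, each disjoint from its translates by the elements of a finite
set `D`, cover all points that are moved by every element of `D`. -/
theorem exists_measurable_cover_of_moved [MeasurableSpace.CountablySeparated X] (D : Finset G) :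
    ∃ E : ℕ → Set X, (∀ n, MeasurableSet (E n)) ∧
      (∀ n, ∀ g ∈ D, ∀ x ∈ E n, g +ᵥ x ∉ E n) ∧
      ∀ x : X, (∀ g ∈ D, g +ᵥ x ≠ x) → ∃ n, x ∈ E n := by
  obtain ⟨f, hf, hinj⟩ := MeasurableSpace.measurable_injection_nat_bool_of_countablySeparated X
  have hcoord : ∀ n : ℕ, Measurable fun x => f x n := fun n => (measurable_pi_apply n).comp hf
  obtain ⟨e, he⟩ := exists_surjective_nat (D → ℕ × Bool)
  -- `e k` prescribes, for each `g`, a coordinate and a bit: `x` has this bit there, `g +ᵥ x` does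
  -- not.
  refine ⟨fun k => {x | ∀ g : D, f x (e k g).1 = (e k g).2 ∧
    f ((g : G) +ᵥ x) (e k g).1 ≠ (e k g).2}, fun k => ?_, ?_, ?_⟩
  · simp only [Set.ofPred_forall]
    refine MeasurableSet.iInter fun g => ?_
    exact (hcoord _ (measurableSet_singleton (e k g).2)).inter
      (((hcoord _).comp (measurable_const_vadd (g : G)))
        (measurableSet_singleton (e k g).2)).compl
  · intro k g hg x hx hgx
    exact (hx ⟨g, hg⟩).2 (hgx ⟨g, hg⟩).1
  · intro x hx
    have h : ∀ g : D, ∃ n : ℕ, f ((g : G) +ᵥ x) n ≠ f x n := fun g =>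
      Function.ne_iff.1 fun h => hx g g.2 (hinj h)
    choose n hn using h
    obtain ⟨k, hk⟩ := he fun g => (n g, f x (n g))
    refine ⟨k, fun g => ?_⟩
    rw [hk]
    exact ⟨rfl, hn g⟩

/-- Among the measurable subsets of `I` which are disjoint from their translates by the elements
of a finite symmetric set `D`, there is one which is maximal as far as the points moved by every
element of `D` are concerned. -/
theorem exists_maximal_disjoint_translates [MeasurableSpace.CountablySeparated X] (D : Finset G)
    (hD : ∀ g ∈ D, -g ∈ D) {I : Set X} (hI : MeasurableSet I) :
    ∃ C ⊆ I, MeasurableSet C ∧ (∀ g ∈ D, ∀ x ∈ C, g +ᵥ x ∉ C) ∧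
      ∀ x ∈ I, (∀ g ∈ D, g +ᵥ x ≠ x) → x ∈ C ∨ ∃ g ∈ D, g +ᵥ x ∈ C := by
  obtain ⟨E, hEm, hEd, hEc⟩ := exists_measurable_cover_of_moved (X := X) D
  -- Greedy choice: stage `k` adds the points of `E k ∩ I` with no `D`-translate in the set built so
  -- far.
  let C : ℕ → Set X := fun n => Nat.rec ∅
    (fun k S => S ∪ ((E k ∩ I) \ ⋃ g ∈ D, (fun x => g +ᵥ x) ⁻¹' S)) n
  have hC : ∀ k, C (k + 1) = C k ∪ ((E k ∩ I) \ ⋃ g ∈ D, (fun x => g +ᵥ x) ⁻¹' C k) :=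
    fun _ => rfl
  have hmono : Monotone C := monotone_nat_of_le_succ fun k => by
    rw [hC]; exact Set.subset_union_left
  refine ⟨⋃ n, C n, Set.iUnion_subset fun n => ?_, MeasurableSet.iUnion fun n => ?_, ?_, ?_⟩
  · induction n with
    | zero => exact Set.empty_subset _
    | succ k ih =>
      rw [hC]
      exact Set.union_subset ih fun x hx => hx.1.2
  · induction n with
    | zero => exact MeasurableSet.empty
    | succ k ih =>
      rw [hC]
      exact ih.union (((hEm k).inter hI).diff
        (D.measurableSet_biUnion fun g _ => measurable_const_vadd g ih))
  · have key : ∀ n, ∀ g ∈ D, ∀ x ∈ C n, g +ᵥ x ∉ C n := by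
      intro n
      induction n with
      | zero => exact fun g _ x hx => absurd hx (Set.notMem_empty x)
      | succ k ih =>
        intro g hg x hx hgx
        rw [hC] at hx hgx
        rcases hx with hx | hx <;> rcases hgx with hgx | hgx
        · exact ih g hg x hx hgx
        · refine hgx.2 (Set.mem_biUnion (hD g hg) ?_)
          simpa using hx
        · exact hx.2 (Set.mem_biUnion hg hgx)
        · exact hEd k g hg x hx.1.1 hgx.1.1
    intro g hg x hx hgx
    obtain ⟨m, hm⟩ := Set.mem_iUnion.1 hx
    obtain ⟨n, hn⟩ := Set.mem_iUnion.1 hgx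
    exact key (max m n) g hg x (hmono (le_max_left m n) hm) (hmono (le_max_right m n) hn)
  · intro x hxI hx
    obtain ⟨k, hk⟩ := hEc x hx
    rcases Classical.em (∃ g ∈ D, g +ᵥ x ∈ C k) with h | h
    · obtain ⟨g, hg, hgx⟩ := h
      exact Or.inr ⟨g, hg, Set.mem_iUnion.2 ⟨k, hgx⟩⟩
    · refine Or.inl (Set.mem_iUnion.2 ⟨k + 1, ?_⟩)
      rw [hC]
      refine Or.inr ⟨⟨hk, hxI⟩, fun hx' => h ?_⟩
      simpa using hx'

end Separation

/-! ### Arithmetic of cubes in `ℤ^d`. -/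

section Cubes

/-- The box `{z : a ≤ z_1, …, z_d ≤ b}` as a finite set. -/
noncomputable def boxFinset (d : ℕ) (a b : ℤ) : Finset (Fin d → ℤ) :=
  Fintype.piFinset fun _ => Finset.Icc a b

theorem mem_boxFinset {d : ℕ} {a b : ℤ} {z : Fin d → ℤ} :
    z ∈ boxFinset d a b ↔ ∀ i, a ≤ z i ∧ z i ≤ b := by
  simp [boxFinset]

theorem coe_boxFinset_one (d N : ℕ) : (boxFinset d 1 N : Set (Fin d → ℤ)) = cube d N := by
  ext z
  simp [mem_boxFinset, cube]

theorem card_boxFinset (d : ℕ) (a b : ℤ) : (boxFinset d a b).card = (b + 1 - a).toNat ^ d := by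
  simp [boxFinset]

/-- For `M, N ≥ 1` this box is the difference set `Q_M - Q_N`, of side `M + N - 1`. -/
theorem card_boxFinset_sub_le (d M N : ℕ) :
    ((boxFinset d (1 - N) (M - 1)).card : ℝ) ≤ ((M : ℝ) + N) ^ d := by
  rw [card_boxFinset]
  have h : ((M : ℤ) - 1 + 1 - (1 - N)).toNat ≤ M + N := by omega
  exact_mod_cast Nat.pow_le_pow_left h d

theorem exists_block_decomposition {d N K : ℕ} (hN : 1 ≤ N) {v : Fin d → ℤ}
    (hv : v ∈ cube d (N * K)) :
    ∃ z ∈ cube d N, ∃ j ∈ boxFinset d 0 (K - 1), v = z + (N : ℤ) • j := by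
  have hN' : (0 : ℤ) < N := by exact_mod_cast hN
  -- Division with remainder, shifted by 1 because cubes start at 1.
  refine ⟨fun i => (v i - 1) % N + 1, fun i => ?_, fun i => (v i - 1) / N, ?_, ?_⟩
  · have h1 := Int.emod_nonneg (v i - 1) hN'.ne'
    have h2 := Int.emod_lt_of_pos (v i - 1) hN'
    constructor <;> dsimp only <;> omega
  · refine mem_boxFinset.2 fun i => ?_
    have hi := hv i
    push_cast at hi
    refine ⟨Int.ediv_nonneg (by omega) hN'.le, Int.le_sub_one_of_lt ?_⟩
    refine Int.ediv_lt_of_lt_mul hN' ?_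
    rw [mul_comm]
    omega
  · ext i
    have := Int.emod_add_mul_ediv (v i - 1) N
    simp only [Pi.add_apply, Pi.smul_apply, smul_eq_mul]
    omega

theorem add_smul_mem_cube {d N K : ℕ} {z j : Fin d → ℤ} (hz : z ∈ cube d N)
    (hj : j ∈ boxFinset d 0 (K - 1)) : z + (N : ℤ) • j ∈ cube d (N * K) := by
  intro i
  have h1 := hz i
  have h2 := mem_boxFinset.1 hj i
  simp only [Pi.add_apply, Pi.smul_apply, smul_eq_mul]
  push_cast
  constructor <;> nlinarith

theorem eq_of_add_smul_eq {d N : ℕ} {z w j k : Fin d → ℤ} (hz : z ∈ cube d N)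
    (hw : w ∈ cube d N) (h : z + (N : ℤ) • j = w + (N : ℤ) • k) : z = w := by
  ext i
  have h1 := hz i
  have h2 := hw i
  have h3 : z i + N * j i = w i + N * k i := congrFun h i
  have h4 : (z i - 1) % N = (w i - 1) % N := by
    rw [← Int.add_mul_emod_self_left (z i - 1) N (j i),
      ← Int.add_mul_emod_self_left (w i - 1) N (k i)]
    congr 1
    omega
  rw [Int.emod_eq_of_lt (by omega) (by omega), Int.emod_eq_of_lt (by omega) (by omega)] at h4
  omega

theorem exists_one_add_one_div_pow_le (d : ℕ) {δ : ℝ} (hδ : 0 < δ) :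
    ∃ K : ℕ, 1 ≤ K ∧ (1 + 1 / (K : ℝ)) ^ d ≤ 1 + δ := by
  have h : Filter.Tendsto (fun K : ℕ => (1 + 1 / (K : ℝ)) ^ d) Filter.atTop (nhds 1) := by
    simpa using (tendsto_one_div_atTop_nhds_zero_nat (𝕜 := ℝ)).const_add 1 |>.pow d
  obtain ⟨K, h1, h2⟩ := ((Filter.eventually_ge_atTop 1).and
    (h.eventually (eventually_le_nhds (lt_add_of_pos_right 1 hδ)))).exists
  exact ⟨K, h1, h2⟩

end Cubes

/-! ### Towers and their enlargement. -/

section Tower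

variable {d N : ℕ} {X : Type*} [AddAction (Fin d → ℤ) X]

theorem mem_tower {B : Set X} {x : X} :
    x ∈ tower d N B ↔ ∃ z ∈ cube d N, ∃ b ∈ B, z +ᵥ b = x := by
  simp only [tower, Set.mem_iUnion, exists_prop]
  rfl

theorem pairwiseDisjoint_vadd_iff {S : Set (Fin d → ℤ)} {B : Set X} :
    (S.PairwiseDisjoint fun z => z +ᵥ B) ↔
      ∀ z ∈ S, ∀ w ∈ S, ∀ b ∈ B, ∀ c ∈ B, z +ᵥ b = w +ᵥ c → z = w := by
  constructor
  · intro h z hz w hw b hb c hc e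
    by_contra hne
    exact Set.disjoint_left.1 (h hz hw hne) (Set.vadd_mem_vadd_set hb)
      (e ▸ Set.vadd_mem_vadd_set hc)
  · intro h z hz w hw hne
    refine Set.disjoint_left.2 ?_
    rintro x ⟨b, hb, rfl⟩ ⟨c, hc, e⟩
    exact hne (h z hz w hw b hb c hc e.symm)

variable [MeasurableSpace X]

theorem measureReal_biUnion_vadd_le (μ : Measure X) [VAddInvariantMeasure (Fin d → ℤ) X μ]
    (P : Finset (Fin d → ℤ)) (B : Set X) :
    μ.real (⋃ z ∈ P, z +ᵥ B) ≤ P.card * μ.real B := by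
  refine (measureReal_biUnion_finset_le P _).trans ?_
  simp [measureReal_def, measure_vadd]

variable [MeasurableConstVAdd (Fin d → ℤ) X]

theorem measurableSet_tower {B : Set X} (hB : MeasurableSet B) : MeasurableSet (tower d N B) := by
  rw [tower, ← coe_boxFinset_one]
  exact Finset.measurableSet_biUnion _ fun z _ => hB.const_vadd z

variable (μ : Measure X) [IsProbabilityMeasure μ] [VAddInvariantMeasure (Fin d → ℤ) X μ]

theorem measureReal_tower {B : Set X} (hB : IsTowerBase d N B) :
    μ.real (tower d N B) = (N : ℝ) ^ d * μ.real B := by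
  have hdisj := hB.2
  rw [tower]
  rw [← coe_boxFinset_one] at hdisj ⊢
  have := measureReal_biUnion_finset (μ := μ) hdisj fun z _ => hB.1.const_vadd z
  simp only [Finset.mem_coe]
  rw [this]
  simp [measureReal_def, measure_vadd, card_boxFinset]

/-- Cutting a tower of height `N * K` into towers of height `N` and adding a maximal family of
cubes in its complement yields a tower of height `N` that is larger by a definite factor. -/
theorem IsTowerBase.exists_larger [MeasurableSpace.CountablySeparated X]
    (hfree : IsFreeAction d μ) {K : ℕ} (hN : 1 ≤ N) (hK : 1 ≤ K) {B : Set X}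
    (hB : IsTowerBase d (N * K) B) :
    ∃ B' : Set X, IsTowerBase d N B' ∧
      μ.real (tower d (N * K) B) +
        (1 - (1 + 1 / (K : ℝ)) ^ d * μ.real (tower d (N * K) B)) / 2 ^ d
        ≤ μ.real (tower d N B') := by
  classical
  have hA := measurableSet_tower (d := d) (N := N * K) hB.1
  set A := tower d (N * K) B with hAdef
  -- The points whose whole cube `Q_N x` misses `A`.
  set I : Set X := (⋃ z ∈ boxFinset d 1 N, (fun x => z +ᵥ x) ⁻¹' A)ᶜ with hIdef
  have hI : MeasurableSet I :=
    (Finset.measurableSet_biUnion _ fun z _ => measurable_const_vadd z hA).compl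
  have hIA : ∀ x ∈ I, ∀ z ∈ cube d N, z +ᵥ x ∉ A := by
    intro x hx z hz hzx
    rw [← coe_boxFinset_one] at hz
    exact hx (Set.mem_biUnion hz hzx)
  -- The nonzero elements of `Q_N - Q_N`: avoiding these translates is what makes `C` a tower base.
  obtain ⟨C, hCI, hCm, hCd, hCmax⟩ := exists_maximal_disjoint_translates (X := X)
    ((boxFinset d (1 - N) (N - 1)).erase 0) (by
      intro g hg
      rw [Finset.mem_erase, mem_boxFinset] at hg ⊢
      refine ⟨neg_ne_zero.2 hg.1, fun i => ?_⟩
      have := hg.2 i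
      simp only [Pi.neg_apply]
      omega) hI
  have hCtower : IsTowerBase d N C := by
    refine ⟨hCm, pairwiseDisjoint_vadd_iff.2 ?_⟩
    intro z hz w hw b hb c hc e
    by_contra hne
    refine hCd (z - w) ?_ b hb ?_
    · rw [Finset.mem_erase, mem_boxFinset]
      refine ⟨sub_ne_zero.2 hne, fun i => ?_⟩
      have h1 := hz i
      have h2 := hw i
      simp only [Pi.sub_apply]
      omega
    · have : (z - w) +ᵥ b = c := by
        rw [sub_eq_neg_add, add_vadd, e, neg_vadd_vadd]
      rwa [this]
  have hCA : Disjoint A (tower d N C) := by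
    refine Set.disjoint_left.2 fun x hxA hxC => ?_
    obtain ⟨z, hz, c, hc, rfl⟩ := mem_tower.1 hxC
    exact hIA c (hCI hc) z hz hxA
  have hIcompl : 1 - (1 + 1 / (K : ℝ)) ^ d * μ.real A ≤ μ.real I := by
    -- If `z +ᵥ x = v +ᵥ b` with `z ∈ Q_N` and `v ∈ Q_{NK}`, then `x = (v - z) +ᵥ b`.
    have hsub : Iᶜ ⊆ ⋃ z ∈ boxFinset d (1 - N) ((N * K : ℕ) - 1), z +ᵥ B := by
      intro x hx
      rw [hIdef, compl_compl] at hx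
      obtain ⟨z, hz, hzx⟩ := Set.mem_iUnion₂.1 hx
      obtain ⟨v, hv, b, hb, e⟩ := mem_tower.1 hzx
      refine Set.mem_biUnion (x := v - z) ?_ ⟨b, hb, ?_⟩
      · rw [Finset.mem_coe, mem_boxFinset]
        intro i
        have h1 := mem_boxFinset.1 hz i
        have h2 := hv i
        simp only [Pi.sub_apply]
        omega
      · change (v - z) +ᵥ b = x
        rw [sub_eq_neg_add, add_vadd, e]
        exact neg_vadd_vadd z x
    have h1 := (measureReal_mono (μ := μ) hsub (measure_ne_top _ _)).trans (measureReal_biUnion_vadd_le μ _ B)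
    have h2 := h1.trans (mul_le_mul_of_nonneg_right (card_boxFinset_sub_le d (N * K) N)
      measureReal_nonneg)
    rw [probReal_compl_eq_one_sub hI] at h2
    have h3 : (1 + 1 / (K : ℝ)) ^ d * μ.real A = (((N * K : ℕ) : ℝ) + N) ^ d * μ.real B := by
      rw [hAdef, measureReal_tower μ hB, ← mul_assoc, ← mul_pow]
      have : (K : ℝ) ≠ 0 := by positivity
      congr 2
      push_cast
      field_simp
    linarith
  have hIC : μ.real I ≤ 2 ^ d * μ.real (tower d N C) := by
    -- Freeness makes the maximality of `C` apply to almost every point of `I`.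
    have hsub : I ≤ᵐ[μ] ⋃ z ∈ boxFinset d (1 - N) (N - 1), z +ᵥ C := by
      filter_upwards [hfree] with x hx hxI
      rcases hCmax x hxI fun g hg => hx g (Finset.ne_of_mem_erase hg) with h | ⟨g, hg, h⟩
      · refine Set.mem_biUnion (x := 0) ?_ ⟨x, h, zero_vadd _ x⟩
        rw [Finset.mem_coe, mem_boxFinset]
        intro i
        simp only [Pi.zero_apply]
        omega
      · refine Set.mem_biUnion (x := -g) ?_ ⟨g +ᵥ x, h, neg_vadd_vadd g x⟩
        rw [Finset.mem_coe, mem_boxFinset]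
        intro i
        have := mem_boxFinset.1 (Finset.mem_of_mem_erase hg) i
        simp only [Pi.neg_apply]
        omega
    have h1 : μ.real I ≤ μ.real (⋃ z ∈ boxFinset d (1 - N) (N - 1), z +ᵥ C) :=
      ENNReal.toReal_mono (measure_ne_top _ _) (measure_mono_ae hsub)
    have h2 := h1.trans (measureReal_biUnion_vadd_le μ _ C)
    have h3 := h2.trans (mul_le_mul_of_nonneg_right (card_boxFinset_sub_le d N N)
      measureReal_nonneg)
    rwa [measureReal_tower μ hCtower, ← mul_assoc, ← mul_pow, two_mul]
  -- The corners of the `K ^ d` blocks cut from the old tower, together with `C`.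
  refine ⟨(⋃ j ∈ boxFinset d 0 (K - 1), ((N : ℤ) • j) +ᵥ B) ∪ C, ⟨?_, ?_⟩, ?_⟩
  · exact (Finset.measurableSet_biUnion _ fun j _ => hB.1.const_vadd _).union hCm
  · have hblock : ∀ z ∈ cube d N, ∀ b ∈ ⋃ j ∈ boxFinset d 0 (K - 1), ((N : ℤ) • j) +ᵥ B,
        z +ᵥ b ∈ A := by
      intro z hz b hb
      obtain ⟨j, hj, b, hb', rfl⟩ := Set.mem_iUnion₂.1 hb
      exact mem_tower.2 ⟨_, add_smul_mem_cube hz hj, b, hb', add_vadd _ _ _⟩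
    refine pairwiseDisjoint_vadd_iff.2 ?_
    intro z hz w hw b hb c hc e
    rcases hb with hb | hb <;> rcases hc with hc | hc
    · obtain ⟨j, hj, b, hb', rfl⟩ := Set.mem_iUnion₂.1 hb
      obtain ⟨k, hk, c, hc', rfl⟩ := Set.mem_iUnion₂.1 hc
      refine eq_of_add_smul_eq hz hw (j := j) (k := k) ?_
      refine pairwiseDisjoint_vadd_iff.1 hB.2 _ (add_smul_mem_cube hz hj) _
        (add_smul_mem_cube hw hk) b hb' c hc' ?_
      rw [add_vadd, add_vadd]
      exact e
    · exact absurd (e ▸ hblock z hz b hb) (hIA c (hCI hc) w hw)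
    · exact absurd (e ▸ hblock w hw c hc) (hIA b (hCI hb) z hz)
    · exact pairwiseDisjoint_vadd_iff.1 hCtower.2 z hz w hw b hb c hc e
  · have hsub : A ∪ tower d N C ⊆
        tower d N ((⋃ j ∈ boxFinset d 0 (K - 1), ((N : ℤ) • j) +ᵥ B) ∪ C) := by
      rintro x (hx | hx)
      · obtain ⟨v, hv, b, hb, rfl⟩ := mem_tower.1 hx
        obtain ⟨z, hz, j, hj, rfl⟩ := exists_block_decomposition hN hv
        exact mem_tower.2 ⟨z, hz, _, Or.inl (Set.mem_biUnion hj (Set.vadd_mem_vadd_set hb)),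
          (add_vadd _ _ _).symm⟩
      · obtain ⟨z, hz, c, hc, rfl⟩ := mem_tower.1 hx
        exact mem_tower.2 ⟨z, hz, c, Or.inr hc, rfl⟩
    refine le_trans ?_ (measureReal_mono hsub)
    rw [measureReal_union hCA (measurableSet_tower hCm)]
    gcongr
    rw [div_le_iff₀ (by positivity), mul_comm (μ.real (tower d N C))]
    exact hIcompl.trans hIC

theorem exists_isTowerBase_one_sub_pow_le [MeasurableSpace.CountablySeparated X]
    (hfree : IsFreeAction d μ) (n : ℕ) (hN : 1 ≤ N) :
    ∃ B : Set X, IsTowerBase d N B ∧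
      1 - (1 - 1 / 2 ^ d / 2 : ℝ) ^ n ≤ μ.real (tower d N B) := by
  -- `N` varies because the step for height `N` starts from a tower of height `N * K`.
  induction n generalizing N with
  | zero =>
    refine ⟨∅, ⟨MeasurableSet.empty, fun z _ w _ _ => by simp [Function.onFun]⟩, ?_⟩
    simp
  | succ n ih =>
    have hc0 : (0 : ℝ) < 1 / 2 ^ d := by positivity
    have hc1 : (1 : ℝ) / 2 ^ d ≤ 1 := by
      rw [div_le_one (by positivity)]
      exact one_le_pow₀ one_le_two
    set c : ℝ := 1 / 2 ^ d with hc
    have hr : 0 < (1 - c / 2) ^ n := pow_pos (by linarith) n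
    set r : ℝ := (1 - c / 2) ^ n with hrdef
    -- The boundary loss is at most `r / 2`. The resulting bound `m + c * (1 - m - r / 2)` increases
    -- with `m` as `c ≤ 1`, and at `m = 1 - r` it equals `1 - r * (1 - c / 2)`.
    obtain ⟨K, hK, hKr⟩ := exists_one_add_one_div_pow_le d (half_pos hr)
    obtain ⟨B, hB, hBr⟩ := ih (N := N * K) (Nat.mul_pos hN hK)
    obtain ⟨B', hB', hle⟩ := hB.exists_larger μ hfree hN hK
    refine ⟨B', hB', le_trans ?_ hle⟩
    have hm1 : μ.real (tower d (N * K) B) ≤ 1 := measureReal_le_one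
    have hm0 : 0 ≤ μ.real (tower d (N * K) B) := measureReal_nonneg
    set m := μ.real (tower d (N * K) B)
    have h1 : (1 + 1 / (K : ℝ)) ^ d * m ≤ m + r / 2 := by nlinarith
    have h2 : c * (1 - m - r / 2) ≤ (1 - (1 + 1 / (K : ℝ)) ^ d * m) / 2 ^ d := by
      rw [div_eq_mul_one_div _ ((2 : ℝ) ^ d), ← hc, mul_comm c]
      exact mul_le_mul_of_nonneg_right (by linarith) hc0.le
    rw [pow_succ, ← hrdef]
    nlinarith

end Tower

theorem theorem4p3 (d : ℕ) {X : Type*} [MeasurableSpace X]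
    [MeasurableSpace.CountablySeparated X]
    [AddAction (Fin d → ℤ) X] [MeasurableConstVAdd (Fin d → ℤ) X]
    (μ : Measure X) [IsProbabilityMeasure μ]
    [ErgodicVAdd (Fin d → ℤ) X μ] (hfree : IsFreeAction d μ)
    (N : ℕ) (hN : 1 ≤ N) (ε : ℝ) (hε : 0 < ε) :
    ∃ B : Set X, IsTowerBase d N B ∧ 1 - ε < μ.real (tower d N B) := by
  have hc0 : (0 : ℝ) < 1 / 2 ^ d := by positivity
  obtain ⟨n, hn⟩ := exists_pow_lt_of_lt_one hε (show (1 - 1 / 2 ^ d / 2 : ℝ) < 1 by linarith)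
  obtain ⟨B, hB, hle⟩ := exists_isTowerBase_one_sub_pow_le μ hfree n hN
  exact ⟨B, hB, by linarith⟩
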